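/- All vector spaces are real, and locally convex spaces are assumed to be Hausdorff. Let $X$ be a Tychonoff (completely regular Hausdorff) space which contains an infinite compact subset, and let $E$ be a locally convex space which contains an isomorphic (i.e. linearly homeomorphic) copy of the Banach space $\ell_1$ of absolutely summable real sequences. Let $E_w$ denote $E$ endowed with its weak topology $\sigma(E,E')$, let $C_p(X,E_w)$ be the space of all continuous functions $X\to E_w$ with the pointwise topology (inherited from the product $(E_w)^X$), and let $(c_0)_p=\{x\in\mathbb{R}^{\mathbb{N}}: x(n)\to 0\}$ carry the pointwise topology inherited from $\mathbb{R}^{\mathbb{N}}$. Then $C_p(X,E_w)$ contains a complemented copy of $(c_0)_p$; that is, there are closed linear subspaces $F_1,F_2$ of $C_p(X,E_w)$ such that $C_p(X,E_w)$ is the algebraic direct sum $F_1\oplus F_2$, the space $F_1$ is linearly homeomorphic to $(c_0)_p$, and the projection of $C_p(X,E_w)$ onto $F_1$ along $F_2$ is continuous. -/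

import Mathlib

open Filter Topology

/-- `C_p(X, F)`: the vector space of all continuous functions `X → F`. As a subspace of the
product `X → F` it carries the pointwise topology. -/
abbrev Cp (X F : Type*) [TopologicalSpace X] [AddCommGroup F] [Module ℝ F] [TopologicalSpace F]
    [IsTopologicalAddGroup F] [ContinuousSMul ℝ F] : Submodule ℝ (X → F) :=
  continuousSubmodule X ℝ F

/-- `(c_0)_p`: the vector space of all real sequences converging to `0`. As a subspace of the
product `ℕ → ℝ` it carries the pointwise topology. -/
def c0p : Submodule ℝ (ℕ → ℝ) where
  carrier := {x | Tendsto x atTop (𝓝 0)}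
  zero_mem' := tendsto_const_nhds
  add_mem' := by
    intro x y hx hy
    have h := Tendsto.add hx hy
    rw [add_zero] at h
    exact h
  smul_mem' := by
    intro c x hx
    have h := Tendsto.const_mul c hx
    rw [mul_zero] at h
    exact h

/-- `F` contains an isomorphic copy of `G`: some linear subspace of `F`, with the subspace
topology, is linearly homeomorphic to `G`. -/
def ContainsCopy (F G : Type*) [AddCommGroup F] [Module ℝ F] [TopologicalSpace F]
    [AddCommGroup G] [Module ℝ G] [TopologicalSpace G] : Prop :=
  ∃ F₁ : Submodule ℝ F, Nonempty (F₁ ≃L[ℝ] G)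

/-- `F` contains a complemented copy of `G`: `F` is the algebraic direct sum of two closed linear
subspaces `F₁` and `F₂` such that `F₁` is linearly homeomorphic to `G` and the projection of `F`
onto `F₁` along `F₂` is continuous. -/
def ContainsComplementedCopy (F G : Type*) [AddCommGroup F] [Module ℝ F] [TopologicalSpace F]
    [AddCommGroup G] [Module ℝ G] [TopologicalSpace G] : Prop :=
  ∃ (F₁ F₂ : Submodule ℝ F) (h : IsCompl F₁ F₂),
    IsClosed (F₁ : Set F) ∧ IsClosed (F₂ : Set F) ∧
    Nonempty (F₁ ≃L[ℝ] G) ∧ Continuous (F₁.projectionOnto F₂ h)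

/-! A copy of `ℓ₁` supplies a weakly bounded sequence `e n` and a continuous seminorm `p` such that
every sign pattern on `e` is realized by a functional below `p`. On the pointwise compact set Ω of
functionals bounded by `p`, and by 1 on `e`, the evaluations at `e n` thus behave like Rademacher
functions, and some probability μ makes them orthonormal. Put `ψ n x = ∫ h x * h (e n) ∂μ`. Then `ψ
n (e n) = 1`, and Bessel gives `ψ n x → 0` for fixed `x`. An Eberlein-type extraction and dominated
convergence extend this to `ψ n (f (x n)) → 0` for `f` weakly continuous on a compact space. With
disjoint bumps `φ n` peaking at points `x n` of the compact set, `T a = ∑ a n • φ n • e n` and `S f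
= (ψ n (f (x n)))` satisfy `S ∘ T = id`. -/

/-! ### Rademacher-type measures and Bessel's inequality -/

open MeasureTheory BoundedContinuousFunction in
/-- If a sequence of continuous functions on a compact space attains every pattern of signs, then
some probability measure makes it orthonormal. -/
theorem exists_probabilityMeasure_orthonormal {Ω : Type*} [TopologicalSpace Ω] [CompactSpace Ω]
    [T2Space Ω] [MeasurableSpace Ω] [BorelSpace Ω] (r : ℕ → C(Ω, ℝ))
    (hr : ∀ s : ℕ → Bool, ∃ h : Ω, ∀ n, r n h = if s n then 1 else -1) :
    ∃ μ : ProbabilityMeasure Ω, ∀ n m, ∫ h, r n h * r m h ∂(μ : Measure Ω) =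
      if n = m then 1 else 0 := by
  choose point hpoint using hr
  let q : (N : ℕ) → (Fin N → Bool) → Ω := fun N s =>
    point fun n => if hn : n < N then s ⟨n, hn⟩ else true
  have hq : ∀ N (s : Fin N → Bool) (n : ℕ) (hn : n < N),
      r n (q N s) = if s ⟨n, hn⟩ then 1 else -1 := by
    intro N s n hn
    simp [q, hpoint, hn]
  let c : ℕ → ENNReal := fun N => (2 ^ N)⁻¹
  -- Uniform weights on the `2 ^ N` patterns of length `N`; the padding value `true` in `q` plays no
  -- role below index `N`.
  let ν : ℕ → Measure Ω := fun N => c N • ∑ s, Measure.dirac (q N s)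
  have hν : ∀ N, IsProbabilityMeasure (ν N) := by
    intro N
    refine ⟨?_⟩
    simp only [ν, c, Measure.smul_apply, Measure.finsetSum_apply, measure_univ, Finset.sum_const,
      Finset.card_univ, Fintype.card_pi, Fintype.card_bool, Finset.prod_const, Fintype.card_fin,
      smul_eq_mul, nsmul_eq_mul, mul_one]
    push_cast
    exact ENNReal.inv_mul_cancel (by simp) (by simp)
  have hint : ∀ N n m, n < N → m < N → ∫ h, r n h * r m h ∂(ν N) = if n = m then 1 else 0 := by
    intro N n m hn hm
    have h1 : ∫ h, r n h * r m h ∂(ν N) =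
        (c N).toReal * ∑ s : Fin N → Bool, r n (q N s) * r m (q N s) := by
      simp only [ν]
      rw [integral_smul_measure, integral_finsetSum_measure]
      · simp
      · intro i _
        exact integrable_dirac (by simp [ENNReal.mul_lt_top])
    rw [h1]
    simp only [hq N _ n hn, hq N _ m hm]
    split_ifs with hnm
    · subst hnm
      have : ∀ s : Fin N → Bool, ((if s ⟨n, hn⟩ then (1 : ℝ) else -1) *
          if s ⟨n, hn⟩ then (1 : ℝ) else -1) = 1 := by
        intro s; split_ifs <;> norm_num
      simp [this, c]
    · set S := ∑ s : Fin N → Bool, (if s ⟨n, hn⟩ then (1 : ℝ) else -1) *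
          if s ⟨m, hm⟩ then (1 : ℝ) else -1 with hS
      -- Flipping the sign at `n` permutes the patterns and negates each summand.
      have hflip : Function.Involutive
          fun s : Fin N → Bool => Function.update s ⟨n, hn⟩ (!s ⟨n, hn⟩) := by
        intro s
        simp
      have h2 : S = -S := by
        conv_lhs => rw [hS, ← Equiv.sum_comp hflip.toPerm]
        rw [hS, ← Finset.sum_neg_distrib]
        refine Finset.sum_congr rfl fun s _ => ?_
        have hne : (⟨m, hm⟩ : Fin N) ≠ ⟨n, hn⟩ := by
          intro h; exact hnm (Fin.mk.inj h).symm
        simp only [Function.Involutive.coe_toPerm, Function.update_self,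
          Function.update_of_ne hne]
        cases s ⟨n, hn⟩ <;> cases s ⟨m, hm⟩ <;> simp
      have : S = 0 := by linarith
      rw [this, mul_zero]
  let P : ℕ → ProbabilityMeasure Ω := fun N => ⟨ν N, hν N⟩
  -- Probability measures on Ω form a compact space, perhaps not sequentially compact, hence an
  -- ultrafilter limit; each integral is eventually constant in `N`.
  let U : Ultrafilter ℕ := hyperfilter ℕ
  let μ := (U.map P).lim
  refine ⟨μ, fun n m => ?_⟩
  have hlim : Tendsto P U (𝓝 μ) := (U.map P).le_nhds_lim
  have h1 := (ProbabilityMeasure.tendsto_iff_forall_integral_tendsto.1 hlim)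
    (mkOfCompact (r n * r m))
  simp only [mkOfCompact_apply, ContinuousMap.mul_apply] at h1
  refine tendsto_nhds_unique h1 (tendsto_const_nhds.congr' ?_)
  have h2 : ∀ᶠ N in (U : Filter ℕ), n < N ∧ m < N :=
    Filter.Tendsto.eventually (f := id) (Nat.hyperfilter_le_atTop)
      ((eventually_gt_atTop n).and (eventually_gt_atTop m))
  filter_upwards [h2] with N hN
  exact (hint N n m hN.1 hN.2).symm

open MeasureTheory in
/-- Bessel's inequality: the integrals of a fixed continuous function against an orthonormal
sequence of continuous functions tend to zero. -/
theorem tendsto_integral_mul_of_orthonormal {Ω : Type*} [TopologicalSpace Ω] [CompactSpace Ω]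
    [MeasurableSpace Ω] [BorelSpace Ω] (μ : Measure Ω) [IsFiniteMeasure μ]
    (r : ℕ → C(Ω, ℝ)) (hr : ∀ n m, ∫ h, r n h * r m h ∂μ = if n = m then 1 else 0)
    (g : C(Ω, ℝ)) : Tendsto (fun n => ∫ h, g h * r n h ∂μ) atTop (𝓝 0) := by
  have hi : ∀ f : C(Ω, ℝ), Integrable (fun h => f h) μ := fun f =>
    f.continuous.integrable_of_hasCompactSupport (HasCompactSupport.of_compactSpace _)
  set c : ℕ → ℝ := fun n => ∫ h, g h * r n h ∂μ with hc
  have hgr : ∀ n, Integrable (fun h => g h * r n h) μ := fun n => hi (g * r n)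
  have hrr : ∀ n m, Integrable (fun h => r n h * r m h) μ := fun n m => hi (r n * r m)
  have key : ∀ s : Finset ℕ, ∑ n ∈ s, c n ^ 2 ≤ ∫ h, g h * g h ∂μ := by
    intro s
    have h0 : 0 ≤ ∫ h, (g h - ∑ n ∈ s, c n * r n h) ^ 2 ∂μ := integral_nonneg fun _ => sq_nonneg _
    have h1 : ∀ h, (g h - ∑ n ∈ s, c n * r n h) ^ 2 = g h * g h -
        2 * ∑ n ∈ s, c n * (g h * r n h) +
        ∑ n ∈ s, ∑ m ∈ s, c n * c m * (r n h * r m h) := by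
      intro h
      have h2 : ∑ n ∈ s, ∑ m ∈ s, c n * c m * (r n h * r m h) =
          (∑ n ∈ s, c n * r n h) * ∑ n ∈ s, c n * r n h := by
        rw [Finset.sum_mul_sum]
        exact Finset.sum_congr rfl fun _ _ => Finset.sum_congr rfl fun _ _ => by ring
      have h3 : ∑ n ∈ s, c n * (g h * r n h) = g h * ∑ n ∈ s, c n * r n h := by
        rw [Finset.mul_sum]
        exact Finset.sum_congr rfl fun _ _ => by ring
      rw [h2, h3]
      ring
    have i1 : Integrable (fun h => ∑ n ∈ s, c n * (g h * r n h)) μ :=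
      integrable_finsetSum _ fun n _ => (hgr n).const_mul _
    have i2 : Integrable (fun h => ∑ n ∈ s, ∑ m ∈ s, c n * c m * (r n h * r m h)) μ :=
      integrable_finsetSum _ fun n _ => integrable_finsetSum _ fun m _ => (hrr n m).const_mul _
    have i0 : Integrable (fun h => g h * g h) μ := hi (g * g)
    simp only [h1] at h0
    have i3 : Integrable (fun h => g h * g h - 2 * ∑ n ∈ s, c n * (g h * r n h)) μ :=
      i0.sub (i1.const_mul 2)
    rw [integral_add i3 i2, integral_sub i0 (i1.const_mul 2),
      integral_const_mul, integral_finsetSum _ fun n _ => (hgr n).const_mul _,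
      integral_finsetSum _ fun n _ => integrable_finsetSum _ fun m _ => (hrr n m).const_mul _]
      at h0
    have h4 : ∑ n ∈ s, ∫ h, ∑ m ∈ s, c n * c m * (r n h * r m h) ∂μ = ∑ n ∈ s, c n ^ 2 := by
      refine Finset.sum_congr rfl fun n hn => ?_
      rw [integral_finsetSum _ fun m _ => (hrr n m).const_mul _]
      simp only [integral_const_mul, hr]
      simp [hn, sq]
    have h5 : ∑ n ∈ s, ∫ h, c n * (g h * r n h) ∂μ = ∑ n ∈ s, c n ^ 2 := by
      refine Finset.sum_congr rfl fun n hn => ?_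
      rw [integral_const_mul, sq]
    rw [h4, h5] at h0
    linarith
  have hs : Summable fun n => c n ^ 2 :=
    summable_of_sum_le (fun n => sq_nonneg _) key
  have h6 := hs.tendsto_atTop_zero
  have h7 : Tendsto (fun n => |c n|) atTop (𝓝 0) := by
    have := (Real.continuous_sqrt.tendsto 0).comp h6
    simpa [Function.comp_def, Real.sqrt_sq_eq_abs] using this
  exact (tendsto_zero_iff_abs_tendsto_zero _).2 h7

/-! ### Sequential extraction and dominated convergence -/

/-- A sequence in one factor of a product of compact spaces has a subsequence along which a
separately continuous function converges pointwise. -/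
theorem exists_subseq_tendsto_of_separatelyContinuous {K Ω : Type*} [TopologicalSpace K]
    [CompactSpace K] [TopologicalSpace Ω] [CompactSpace Ω] [Nonempty Ω] (F : K → Ω → ℝ)
    (h₁ : ∀ x, Continuous (F x)) (h₂ : ∀ h, Continuous fun x => F x h) (x : ℕ → K) :
    ∃ (φ : ℕ → ℕ) (y : K), StrictMono φ ∧
      ∀ h, Tendsto (fun n => F (x (φ n)) h) atTop (𝓝 (F y h)) := by
  let Φ : Ω → ℕ → ℝ := fun h n => F (x n) h
  have hΦ : Continuous Φ := continuous_pi fun n => h₁ (x n)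
  -- The range lies in the separable metrizable space `ℕ → ℝ`, so countably many `d i` suffice to
  -- choose the subsequence.
  obtain ⟨d', hd'⟩ := TopologicalSpace.exists_dense_seq (Set.range Φ)
  choose d hd using fun i => (d' i).2
  obtain ⟨a, -, φ, hφ, hconv⟩ :=
    (isCompact_univ_pi fun i => isCompact_range (h₂ (d i))).tendsto_subseq
      (x := fun n i => F (x n) (d i)) fun n i _ => Set.mem_range_self (x n)
  have hconv' : ∀ i, Tendsto (fun n => F (x (φ n)) (d i)) atTop (𝓝 (a i)) :=
    fun i => (tendsto_pi_nhds.1 hconv) i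
  have lim : ∀ V : Ultrafilter ℕ, ∀ h,
      Tendsto (fun n => F (x (φ n)) h) V (𝓝 (F (V.map (x ∘ φ)).lim h)) := fun V h =>
    ((h₂ h).tendsto _).comp (V.map (x ∘ φ)).le_nhds_lim
  -- All cluster points give the same function: `h` may be replaced by a cluster point `h'` of the
  -- `d i` that no `F (x n)` distinguishes from `h`. The limit functions agree at each `d i`, hence
  -- at `h'` by continuity.
  have key : ∀ V W : Ultrafilter ℕ, (V : Filter ℕ) ≤ atTop → (W : Filter ℕ) ≤ atTop →
      ∀ h, F (V.map (x ∘ φ)).lim h = F (W.map (x ∘ φ)).lim h := by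
    intro V W hV hW h
    have hcl : (⟨Φ h, Set.mem_range_self h⟩ : Set.range Φ) ∈ closure (Set.range d') := hd' _
    obtain ⟨G', hG', hG⟩ := mem_closure_iff_ultrafilter.1 hcl
    obtain ⟨G, hGd⟩ : ∃ G : Ultrafilter ℕ, Tendsto d' G (𝓝 ⟨Φ h, Set.mem_range_self h⟩) := by
      refine ⟨G'.ofComapInfPrincipal (m := d') (s := Set.univ) (by simpa using hG'), ?_⟩
      have := Ultrafilter.ofComapInfPrincipal_eq_of_map (m := d') (s := Set.univ)
        (g := G') (by simpa using hG')
      rw [Tendsto, ← Ultrafilter.coe_map, this]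
      exact hG
    have hGΦ : ∀ n, Tendsto (fun i => F (x n) (d i)) G (𝓝 (F (x n) h)) := by
      intro n
      have h3 := ((continuous_apply n).comp continuous_subtype_val).continuousAt.tendsto.comp hGd
      have : ∀ i, F (x n) (d i) = (d' i).1 n := fun i => by rw [← hd i]
      simpa [Function.comp_def, this] using h3
    set h' : Ω := (G.map d).lim with hh'
    have hGd' : Tendsto d G (𝓝 h') := (G.map d).le_nhds_lim
    have heq : ∀ n, F (x n) h' = F (x n) h := fun n =>
      tendsto_nhds_unique (((h₁ (x n)).tendsto h').comp hGd') (hGΦ n)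
    have hV' : ∀ V : Ultrafilter ℕ, F (V.map (x ∘ φ)).lim h = F (V.map (x ∘ φ)).lim h' := by
      intro V
      refine tendsto_nhds_unique (lim V h) ?_
      simpa [heq] using lim V h'
    rw [hV' V, hV' W]
    have hi : ∀ i, F (V.map (x ∘ φ)).lim (d i) = F (W.map (x ∘ φ)).lim (d i) := by
      intro i
      rw [tendsto_nhds_unique (lim V (d i)) ((hconv' i).mono_left hV),
        tendsto_nhds_unique (lim W (d i)) ((hconv' i).mono_left hW)]
    refine tendsto_nhds_unique (((h₁ _).tendsto h').comp hGd') ?_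
    exact (((h₁ (W.map (x ∘ φ)).lim).tendsto h').comp hGd').congr fun i => (hi i).symm
  refine ⟨φ, ((hyperfilter ℕ).map (x ∘ φ)).lim, hφ, fun h => ?_⟩
  rw [tendsto_iff_ultrafilter]
  intro V hV
  rw [key (hyperfilter ℕ) V Nat.hyperfilter_le_atTop hV h]
  exact lim V h

open MeasureTheory in
/-- A uniformly bounded, separately continuous family of functions on a compact space carries
sequences to integrals that tend to zero, as soon as this holds for constant sequences. -/
theorem tendsto_integral_mul_of_separatelyContinuous {K Ω : Type*} [TopologicalSpace K]
    [CompactSpace K] [TopologicalSpace Ω] [CompactSpace Ω] [Nonempty Ω] [MeasurableSpace Ω]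
    [BorelSpace Ω] (μ : Measure Ω) [IsFiniteMeasure μ] (r : ℕ → C(Ω, ℝ))
    (hr : ∀ n h, |r n h| ≤ 1) (F : K → Ω → ℝ)
    (h₁ : ∀ x, Continuous (F x)) (h₂ : ∀ h, Continuous fun x => F x h)
    {C : ℝ} (hC : ∀ x h, |F x h| ≤ C)
    (hF : ∀ y, Tendsto (fun n => ∫ h, F y h * r n h ∂μ) atTop (𝓝 0)) (x : ℕ → K) :
    Tendsto (fun n => ∫ h, F (x n) h * r n h ∂μ) atTop (𝓝 0) := by
  refine tendsto_of_subseq_tendsto fun ns hns => ?_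
  obtain ⟨φ, y, hφ, hlim⟩ := exists_subseq_tendsto_of_separatelyContinuous F h₁ h₂ (x ∘ ns)
  refine ⟨φ, ?_⟩
  have hi : ∀ f : Ω → ℝ, Continuous f → Integrable f μ := fun f hf =>
    hf.integrable_of_hasCompactSupport (HasCompactSupport.of_compactSpace _)
  have t1 : Tendsto (fun n => ∫ h, (F (x (ns (φ n))) h - F y h) * r (ns (φ n)) h ∂μ) atTop
      (𝓝 (∫ _, 0 ∂μ)) := by
    refine tendsto_integral_of_dominated_convergence (fun _ => 2 * C) (fun n => ?_)
      (integrable_const _) (fun n => ?_) ?_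
    · exact (hi _ (((h₁ _).sub (h₁ _)).mul (r _).continuous)).aestronglyMeasurable
    · refine Eventually.of_forall fun h => ?_
      rw [Real.norm_eq_abs, abs_mul]
      have b1 := abs_sub (F (x (ns (φ n))) h) (F y h)
      have b2 := hC (x (ns (φ n))) h
      have b3 := hC y h
      have b4 := hr (ns (φ n)) h
      nlinarith [abs_nonneg (F (x (ns (φ n))) h - F y h)]
    · refine Eventually.of_forall fun h => ?_
      have b1 : Tendsto (fun n => F (x (ns (φ n))) h - F y h) atTop (𝓝 0) := by
        simpa using (hlim h).sub_const (F y h)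
      refine squeeze_zero_norm (fun n => ?_) ((tendsto_zero_iff_abs_tendsto_zero _).1 b1)
      rw [Real.norm_eq_abs, abs_mul]
      exact mul_le_of_le_one_right (abs_nonneg _) (hr _ _)
  have t2 : Tendsto (fun n => ∫ h, F y h * r (ns (φ n)) h ∂μ) atTop (𝓝 0) :=
    (hF y).comp (hns.comp hφ.tendsto_atTop)
  have t3 := t1.add t2
  simp only [integral_zero, add_zero] at t3
  refine t3.congr fun n => ?_
  have i1 : Integrable (fun h => (F (x (ns (φ n))) h - F y h) * r (ns (φ n)) h) μ :=
    hi _ (((h₁ _).sub (h₁ _)).mul (r _).continuous)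
  have i2 : Integrable (fun h => F y h * r (ns (φ n)) h) μ :=
    hi _ ((h₁ _).mul (r _).continuous)
  rw [← integral_add i1 i2]
  exact integral_congr_ae (Eventually.of_forall fun h => by ring)

/-! ### Functionals dominated by a seminorm -/

/-- Uniform boundedness: a family of vectors that is bounded on each functional of the polar of a
seminorm is uniformly bounded on that polar. -/
theorem Seminorm.exists_forall_abs_le_of_pointwise_bounded {E ι : Type*} [AddCommGroup E]
    [Module ℝ E] (p : Seminorm ℝ E) (v : ι → E)
    (hv : ∀ g : E →ₗ[ℝ] ℝ, (∀ x, |g x| ≤ p x) → ∃ C, ∀ i, |g (v i)| ≤ C) :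
    ∃ C, ∀ i, ∀ g : E →ₗ[ℝ] ℝ, (∀ x, |g x| ≤ p x) → |g (v i)| ≤ C := by
  let : SeminormedAddCommGroup E := p.toAddGroupSeminorm.toSeminormedAddCommGroup
  have hnorm : ∀ x : E, ‖x‖ = p x := fun _ => rfl
  let : NormedSpace ℝ E := ⟨fun a b => by rw [hnorm, hnorm, map_smul_eq_mul]⟩
  -- Banach–Steinhaus is applied on the dual of `(E, p)`, which is complete even if `E` is not.
  have hb : ∀ g : StrongDual ℝ E, ∃ C, ∀ i,
      ‖ContinuousLinearMap.apply ℝ ℝ (v i) g‖ ≤ C := by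
    intro g
    have hpos : (0 : ℝ) < ‖g‖ + 1 := by positivity
    obtain ⟨C, hC⟩ := hv ((‖g‖ + 1)⁻¹ • g.toLinearMap) (fun x => by
      have h1 := g.le_opNorm x
      rw [hnorm, Real.norm_eq_abs] at h1
      simp only [LinearMap.smul_apply, ContinuousLinearMap.coe_coe, smul_eq_mul, abs_mul,
        abs_inv, abs_of_pos hpos]
      rw [inv_mul_le_iff₀ hpos]
      nlinarith [apply_nonneg p x])
    refine ⟨(‖g‖ + 1) * C, fun i => ?_⟩
    have h2 := hC i
    simp only [LinearMap.smul_apply, ContinuousLinearMap.coe_coe, smul_eq_mul, abs_mul,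
        abs_inv, abs_of_pos hpos] at h2
    rw [inv_mul_le_iff₀ hpos] at h2
    simpa using h2
  obtain ⟨C, hC⟩ := banach_steinhaus hb
  refine ⟨C, fun i g hg => ?_⟩
  let g' : StrongDual ℝ E := g.mkContinuous 1 fun x => by
    rw [one_mul, Real.norm_eq_abs, hnorm]; exact hg x
  have h1 : ‖g'‖ ≤ 1 := g.mkContinuous_norm_le zero_le_one _
  have h2 := (ContinuousLinearMap.apply ℝ ℝ (v i)).le_of_opNorm_le (hC i) g'
  have h3 : 0 ≤ C := (norm_nonneg _).trans (hC i)
  calc |g (v i)| ≤ C * ‖g'‖ := h2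
    _ ≤ C * 1 := by gcongr
    _ = C := mul_one C

/-- The set of linear functionals dominated by a seminorm and by `1` along a given sequence, as a
set of functions. -/
def dominatedFunctionals {E : Type*} [AddCommGroup E] [Module ℝ E] (p : Seminorm ℝ E)
    (e : ℕ → E) : Set (E → ℝ) :=
  {h | (∀ x y, h (x + y) = h x + h y) ∧ (∀ (c : ℝ) x, h (c • x) = c * h x) ∧
    (∀ x, |h x| ≤ p x) ∧ ∀ n, |h (e n)| ≤ 1}

/-- Banach–Alaoglu: the defining conditions are pointwise closed and confine the set to a product of
intervals. -/
theorem isCompact_dominatedFunctionals {E : Type*} [AddCommGroup E] [Module ℝ E]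
    (p : Seminorm ℝ E) (e : ℕ → E) : IsCompact (dominatedFunctionals p e) := by
  refine (isCompact_univ_pi fun x => isCompact_Icc (a := -p x) (b := p x)).of_isClosed_subset ?_
    fun h hh x _ => abs_le.1 (hh.2.2.1 x)
  simp only [dominatedFunctionals, Set.ofPred_and, Set.ofPred_forall]
  refine IsClosed.inter ?_ (IsClosed.inter ?_ (IsClosed.inter ?_ ?_))
  · exact isClosed_iInter fun x => isClosed_iInter fun y => isClosed_eq (by fun_prop) (by fun_prop)
  · exact isClosed_iInter fun c => isClosed_iInter fun x => isClosed_eq (by fun_prop) (by fun_prop)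
  · exact isClosed_iInter fun x => isClosed_le (by fun_prop) (by fun_prop)
  · exact isClosed_iInter fun n => isClosed_le (by fun_prop) (by fun_prop)

/-- The linear functional underlying an element of `dominatedFunctionals`. -/
def dominatedFunctionals.toLinearMap {E : Type*} [AddCommGroup E] [Module ℝ E]
    {p : Seminorm ℝ E} {e : ℕ → E} (h : dominatedFunctionals p e) : E →ₗ[ℝ] ℝ where
  toFun := h.1
  map_add' := h.2.1
  map_smul' := h.2.2.1

/-- A linear functional dominated by a continuous seminorm is continuous. -/
theorem LinearMap.continuous_of_abs_le_seminorm {E : Type*} [AddCommGroup E] [Module ℝ E]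
    [TopologicalSpace E] [IsTopologicalAddGroup E] {p : Seminorm ℝ E} (hp : Continuous p)
    (g : E →ₗ[ℝ] ℝ) (hg : ∀ x, |g x| ≤ p x) : Continuous g := by
  refine continuous_of_continuousAt_zero g.toAddMonoidHom ?_
  have h1 : Tendsto p (𝓝 0) (𝓝 0) := by simpa using hp.tendsto 0
  have h2 : Tendsto g (𝓝 0) (𝓝 0) := squeeze_zero_norm hg h1
  simpa [ContinuousAt] using h2

/-- If a sequence `e` in a locally convex space behaves like the basis of `ℓ₁`, then there are
functionals `ψ n` with `ψ n (e n) = 1` that tend to zero along every sequence contained in a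
weakly continuous image of a compact space. -/
theorem exists_strongDual_tendsto_zero {E : Type*} [AddCommGroup E] [Module ℝ E]
    [TopologicalSpace E] [IsTopologicalAddGroup E]
    (p : Seminorm ℝ E) (hp : Continuous p) (e : ℕ → E)
    (he : ∀ s : ℕ → Bool, ∃ g : E →ₗ[ℝ] ℝ, (∀ n, g (e n) = if s n then 1 else -1) ∧
      ∀ x, |g x| ≤ p x) :
    ∃ ψ : ℕ → StrongDual ℝ E, (∀ n, ψ n (e n) = 1) ∧
      ∀ {K : Type*} [TopologicalSpace K] [CompactSpace K] (f : K → E),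
        (∀ g : StrongDual ℝ E, Continuous fun x => g (f x)) →
        ∀ x : ℕ → K, Tendsto (fun n => ψ n (f (x n))) atTop (𝓝 0) := by
  let Ω := dominatedFunctionals p e
  have : CompactSpace Ω := isCompact_iff_compactSpace.1 (isCompact_dominatedFunctionals p e)
  let : MeasurableSpace Ω := borel Ω
  have : BorelSpace Ω := ⟨rfl⟩
  let ev : E → C(Ω, ℝ) := fun x => ⟨fun h => h.1 x, (continuous_apply x).comp continuous_subtype_val⟩
  have hev : ∀ n (h : Ω), |ev (e n) h| ≤ 1 := fun n h => h.2.2.2.2 n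
  have hsign : ∀ s : ℕ → Bool, ∃ h : Ω, ∀ n, ev (e n) h = if s n then 1 else -1 := by
    intro s
    obtain ⟨g, hg, hgp⟩ := he s
    refine ⟨⟨g, map_add g, fun c x => by simp, hgp, fun n => ?_⟩, hg⟩
    rw [hg]
    split_ifs <;> simp
  have : Nonempty Ω := ⟨(hsign fun _ => true).choose⟩
  obtain ⟨μ, hμ⟩ := exists_probabilityMeasure_orthonormal (fun n => ev (e n)) hsign
  have hi : ∀ f : C(Ω, ℝ), MeasureTheory.Integrable (fun h => f h) (μ : MeasureTheory.Measure Ω) :=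
    fun f => f.continuous.integrable_of_hasCompactSupport (HasCompactSupport.of_compactSpace _)
  have hi' : ∀ x n, MeasureTheory.Integrable (fun h : Ω => h.1 x * h.1 (e n))
      (μ : MeasureTheory.Measure Ω) := fun x n => hi (ev x * ev (e n))
  let ψ' : ℕ → E →ₗ[ℝ] ℝ := fun n =>
    { toFun := fun x => ∫ h : Ω, h.1 x * h.1 (e n) ∂(μ : MeasureTheory.Measure Ω)
      map_add' := fun x y => by
        rw [← MeasureTheory.integral_add (hi' x n) (hi' y n)]
        refine MeasureTheory.integral_congr_ae (Eventually.of_forall fun h => ?_)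
        simp only [h.2.1, add_mul]
      map_smul' := fun c x => by
        rw [RingHom.id_apply, smul_eq_mul, ← MeasureTheory.integral_const_mul]
        refine MeasureTheory.integral_congr_ae (Eventually.of_forall fun h => ?_)
        simp only [h.2.2.1, mul_assoc] }
  have hψ' : ∀ n x, |ψ' n x| ≤ p x := by
    intro n x
    have h1 := MeasureTheory.norm_integral_le_of_norm_le_const
      (μ := (μ : MeasureTheory.Measure Ω)) (f := fun h : Ω => h.1 x * h.1 (e n)) (C := p x)
      (Eventually.of_forall fun h => by
        rw [Real.norm_eq_abs, abs_mul]
        exact (mul_le_of_le_one_right (abs_nonneg _) (h.2.2.2.2 n)).trans (h.2.2.2.1 x))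
    rw [MeasureTheory.probReal_univ, mul_one] at h1
    exact h1
  refine ⟨fun n => ⟨ψ' n, (ψ' n).continuous_of_abs_le_seminorm hp (hψ' n)⟩, fun n => ?_, ?_⟩
  · have := hμ n n
    rw [if_pos rfl] at this
    exact this
  · intro K _ _ f hf x
    have hcont : ∀ g : E →ₗ[ℝ] ℝ, (∀ x, |g x| ≤ p x) → Continuous fun x => g (f x) :=
      fun g hg => hf ⟨g, g.continuous_of_abs_le_seminorm hp hg⟩
    obtain ⟨C, hC⟩ := p.exists_forall_abs_le_of_pointwise_bounded f fun g hg => by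
      obtain ⟨C, hC⟩ := (isCompact_range (hcont g hg)).isBounded.exists_norm_le
      exact ⟨C, fun i => hC _ (Set.mem_range_self i)⟩
    exact tendsto_integral_mul_of_separatelyContinuous (μ : MeasureTheory.Measure Ω)
      (fun n => ev (e n)) hev (fun x h => h.1 (f x)) (fun x => (ev (f x)).continuous)
      (fun h => hcont (dominatedFunctionals.toLinearMap h) h.2.2.2.1)
      (fun x h => hC x (dominatedFunctionals.toLinearMap h) h.2.2.2.1)
      (fun y => tendsto_integral_mul_of_orthonormal _ (fun n => ev (e n)) hμ (ev (f y))) x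

/-! ### Disjoint bumps in Tychonoff spaces -/

/-- An infinite subset of a regular Hausdorff space meets each member of some sequence of pairwise
disjoint open sets. -/
theorem Set.Infinite.exists_seq_isOpen_disjoint {X : Type*} [TopologicalSpace X] [T3Space X]
    {K : Set X} (hK : K.Infinite) :
    ∃ (x : ℕ → X) (U : ℕ → Set X), (∀ n, x n ∈ K) ∧ (∀ n, IsOpen (U n)) ∧ (∀ n, x n ∈ U n) ∧
      ∀ m n, m ≠ n → Disjoint (U m) (U n) := by
  have step : ∀ W : {W : Set X // IsOpen W ∧ (K ∩ W).Infinite},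
      ∃ (x : X) (U : Set X) (V : {W : Set X // IsOpen W ∧ (K ∩ W).Infinite}),
        x ∈ K ∧ IsOpen U ∧ x ∈ U ∧ U ⊆ W.1 ∧ V.1 ⊆ W.1 ∧ Disjoint U V.1 := by
    rintro ⟨W, hW, hKW⟩
    have aux : ∀ x ∈ K ∩ W, ∀ U : Set X, IsOpen U → x ∈ U → ((K ∩ W) \ closure U).Infinite →
        ∃ (x : X) (U : Set X) (V : {W : Set X // IsOpen W ∧ (K ∩ W).Infinite}),
          x ∈ K ∧ IsOpen U ∧ x ∈ U ∧ U ⊆ W ∧ V.1 ⊆ W ∧ Disjoint U V.1 := by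
      intro x hx U hU hxU hinf
      refine ⟨x, U ∩ W, ⟨W \ closure U, hW.sdiff isClosed_closure, ?_⟩, hx.1, hU.inter hW,
        ⟨hxU, hx.2⟩, Set.inter_subset_right, Set.sdiff_subset, ?_⟩
      · rwa [← Set.inter_sdiff_assoc]
      · exact Set.disjoint_left.2 fun z hz hz' => hz'.2 (subset_closure hz.1)
    obtain ⟨x, hx, y, hy, hxy⟩ := hKW.nontrivial
    -- As the closures are disjoint, removing one of them leaves infinitely many points of `K ∩ W`.
    obtain ⟨U, hxU, hU, V, hyV, hV, hUV⟩ := exists_open_nhds_disjoint_closure hxy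
    by_cases h : ((K ∩ W) \ closure U).Infinite
    · exact aux x hx U hU hxU h
    · refine aux y hy V hV hyV fun hfin => hKW ?_
      refine ((Set.not_infinite.1 h).union hfin).subset fun z hz => ?_
      by_cases hzU : z ∈ closure U
      · exact Or.inr ⟨hz, fun hzV => Set.disjoint_left.1 hUV hzU hzV⟩
      · exact Or.inl ⟨hz, hzU⟩
  choose x U V hx hU hxU hUW hVW hUV using step
  let W : ℕ → {W : Set X // IsOpen W ∧ (K ∩ W).Infinite} := fun n =>
    V^[n] ⟨Set.univ, isOpen_univ, by rwa [Set.inter_univ]⟩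
  have hW : ∀ n, W (n + 1) = V (W n) := fun n => Function.iterate_succ_apply' V n _
  have hanti : Antitone fun n => (W n).1 := antitone_nat_of_succ_le fun n => by
    rw [hW]; exact hVW (W n)
  have hlt : ∀ m n, m < n → Disjoint (U (W m)) (U (W n)) := by
    intro m n hmn
    refine (hUV (W m)).mono_right ((hUW (W n)).trans ?_)
    rw [← hW]
    exact hanti hmn
  refine ⟨fun n => x (W n), fun n => U (W n), fun n => hx _, fun n => hU _, fun n => hxU _,
    fun m n hmn => ?_⟩
  rcases lt_or_gt_of_ne hmn with h | h
  · exact hlt m n h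
  · exact (hlt n m h).symm

/-- An infinite subset of a Tychonoff space contains the peaks of a sequence of disjointly
supported continuous functions; `N y` is the only index whose function may be nonzero at `y`. -/
theorem Set.Infinite.exists_seq_disjoint_bumps {X : Type*} [TopologicalSpace X] [T35Space X]
    {K : Set X} (hK : K.Infinite) :
    ∃ (x : ℕ → X) (φ : ℕ → X → ℝ) (N : X → ℕ), (∀ n, x n ∈ K) ∧ (∀ n, Continuous (φ n)) ∧
      (∀ n y, |φ n y| ≤ 1) ∧ (∀ n, φ n (x n) = 1) ∧ ∀ n y, n ≠ N y → φ n y = 0 := by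
  obtain ⟨x, U, hx, hU, hxU, hd⟩ := hK.exists_seq_isOpen_disjoint
  choose f hf hfx hfU using fun n =>
    CompletelyRegularSpace.completely_regular_isOpen (x n) (U n) (hU n) (hxU n)
  have hsupp : ∀ n y, y ∉ U n → (1 - (f n y : ℝ)) = 0 := by
    intro n y hy
    simp [hfU n hy]
  have hN : ∀ y, ∃ k, ∀ n, n ≠ k → (1 - (f n y : ℝ)) = 0 := by
    intro y
    by_cases h : ∃ k, y ∈ U k
    · obtain ⟨k, hk⟩ := h
      exact ⟨k, fun n hn => hsupp n y fun hy => Set.disjoint_left.1 (hd n k hn) hy hk⟩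
    · exact ⟨0, fun n _ => hsupp n y fun hy => h ⟨n, hy⟩⟩
  choose N hN using hN
  refine ⟨x, fun n y => 1 - (f n y : ℝ), N, hx, fun n => ?_, fun n y => ?_, fun n => ?_,
    fun n y hn => hN y n hn⟩
  · exact continuous_const.sub (continuous_subtype_val.comp (hf n))
  · have := (f n y).2
    rw [abs_le]
    constructor <;> linarith [this.1, this.2]
  · simp [hfx n]

/-- A combination of disjointly supported continuous functions is continuous if its coefficients
tend to zero. -/
theorem continuous_of_disjoint_bumps {X : Type*} [TopologicalSpace X] {φ : ℕ → X → ℝ}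
    {N : X → ℕ} (hφ : ∀ n, Continuous (φ n)) (hφ1 : ∀ n y, |φ n y| ≤ 1)
    (hN : ∀ n y, n ≠ N y → φ n y = 0) {b : ℕ → ℝ} (hb : Tendsto b atTop (𝓝 0)) :
    Continuous fun y => b (N y) * φ (N y) y := by
  -- At each point at most one term is nonzero, so the tail is bounded by a single late coefficient.
  have hu : TendstoUniformly (fun M y => ∑ n ∈ Finset.range M, b n * φ n y)
      (fun y => b (N y) * φ (N y) y) atTop := by
    rw [Metric.tendstoUniformly_iff]
    intro ε hε
    obtain ⟨M₀, hM₀⟩ := Metric.tendsto_atTop.1 hb ε hε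
    filter_upwards [eventually_ge_atTop M₀] with M hM y
    by_cases h : N y < M
    · rw [Finset.sum_eq_single_of_mem (N y) (Finset.mem_range.2 h)
        fun n _ hn => by rw [hN n y hn, mul_zero], dist_self]
      exact hε
    · rw [Finset.sum_eq_zero fun n hn => by
        rw [hN n y (by rw [Finset.mem_range] at hn; omega), mul_zero]]
      rw [Real.dist_eq, sub_zero, abs_mul]
      refine (mul_le_of_le_one_right (abs_nonneg _) (hφ1 _ _)).trans_lt ?_
      simpa [Real.dist_eq] using hM₀ (N y) (by omega)
  refine hu.continuous (Frequently.of_forall fun M => ?_)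
  exact continuous_finsetSum _ fun n _ => continuous_const.mul (hφ n)

/-! ### Complemented copies and the final construction -/

/-- A pair of continuous linear maps `T : G → F` and `S : F → G` with `S ∘ T = id` produces a
complemented copy of `G` in `F`. -/
theorem ContainsComplementedCopy.of_leftInverse {F G : Type*} [AddCommGroup F] [Module ℝ F]
    [TopologicalSpace F] [IsTopologicalAddGroup F] [T2Space F]
    [AddCommGroup G] [Module ℝ G] [TopologicalSpace G]
    (T : G →L[ℝ] F) (S : F →L[ℝ] G) (h : Function.LeftInverse S T) :
    ContainsComplementedCopy F G := by
  have hc := T.isTopCompl_range_ker_of_leftInverse S h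
  refine ⟨_, _, hc.isCompl, hc.isClosed, hc.isClosed', ⟨?_⟩, hc.continuous_projectionOnto⟩
  refine ContinuousLinearEquiv.symm
    { LinearEquiv.ofLeftInverse (f := T.toLinearMap) (g := S) h with
      continuous_toFun := ?_
      continuous_invFun := ?_ }
  · exact T.continuous.subtype_mk _
  · exact S.continuous.comp continuous_subtype_val

/-- A copy of `ℓ₁` in a locally convex space yields a weakly bounded sequence on which all patterns
of signs are attained by functionals dominated by one continuous seminorm. -/
theorem ContainsCopy.exists_seq_of_lp_one {E : Type*} [AddCommGroup E] [Module ℝ E]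
    [TopologicalSpace E] [IsTopologicalAddGroup E] [ContinuousSMul ℝ E] [LocallyConvexSpace ℝ E]
    (hE : ContainsCopy E (lp (fun _ : ℕ => ℝ) 1)) :
    ∃ (p : Seminorm ℝ E) (e : ℕ → E), Continuous p ∧
      (∀ g : StrongDual ℝ E, ∃ C, ∀ n, |g (e n)| ≤ C) ∧
      ∀ s : ℕ → Bool, ∃ g : E →ₗ[ℝ] ℝ, (∀ n, g (e n) = if s n then 1 else -1) ∧
        ∀ x, |g x| ≤ p x := by
  obtain ⟨F₁, ⟨i⟩⟩ := hE
  obtain ⟨p, hp, hle⟩ := Seminorm.exists_le_comp_of_isInducing (f := F₁.subtype)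
    (p := (normSeminorm ℝ (lp (fun _ : ℕ => ℝ) 1)).comp i.toLinearEquiv.toLinearMap)
    (continuous_norm.comp i.continuous) IsInducing.subtypeVal
  have hle' : ∀ v : F₁, ‖i v‖ ≤ p v := fun v => hle v
  refine ⟨p, fun n => (i.symm (lp.single 1 n 1) : F₁), hp, fun g => ?_, fun s => ?_⟩
  · let L : lp (fun _ : ℕ => ℝ) 1 →L[ℝ] ℝ :=
      (g.comp F₁.subtypeL).comp i.symm.toContinuousLinearMap
    refine ⟨‖L‖, fun n => ?_⟩
    have h1 := L.le_opNorm (lp.single 1 n 1)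
    rw [lp.norm_single (by simp)] at h1
    simpa [L] using h1
  · let σ : ℕ → ℝ := fun n => if s n then 1 else -1
    have hσ : ∀ n t, |σ n * t| = |t| := by
      intro n t
      by_cases h : s n <;> simp [σ, h]
    have habs : ∀ a : lp (fun _ : ℕ => ℝ) 1, Summable fun n => |a n| := by
      intro a
      simpa using (memℓp_gen_iff (by simp)).1 (lp.memℓp a)
    have hsum : ∀ a : lp (fun _ : ℕ => ℝ) 1, Summable fun n => σ n * a n := fun a =>
      Summable.of_abs (by simpa only [hσ] using habs a)
    -- The sign functional is bounded by the `ℓ₁` norm, hence by `p`, so Hahn–Banach extends it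
    -- under `p`.
    let f : F₁ →ₗ[ℝ] ℝ :=
      { toFun := fun v => ∑' n, σ n * i v n
        map_add' := fun v w => by
          rw [← (hsum _).tsum_add (hsum _)]
          exact tsum_congr fun n => by simp [mul_add]
        map_smul' := fun c v => by
          rw [RingHom.id_apply, smul_eq_mul, ← tsum_mul_left]
          exact tsum_congr fun n => by simp [mul_left_comm] }
    obtain ⟨g, hg, hgp⟩ := Module.Dual.exists_extension_of_le_seminorm_real F₁ f (p := p)
      fun v => by
        refine le_trans ?_ (hle' v)
        rw [lp.norm_eq_tsum_rpow (by simp)]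
        simp only [ENNReal.toReal_one, Real.rpow_one, div_one, Real.norm_eq_abs]
        exact (hsum _).tsum_le_tsum (fun n => (le_abs_self _).trans (hσ n _).le) (habs _)
    refine ⟨g, fun n => ?_, hgp⟩
    rw [hg]
    change ∑' m, σ m * i (i.symm (lp.single 1 n 1)) m = σ n
    rw [i.apply_symm_apply, tsum_eq_single n fun m hm => by
      rw [lp.single_apply_ne _ _ _ hm, mul_zero], lp.single_apply_self, mul_one]

theorem mainTheorem6 {X E : Type*} [TopologicalSpace X] [T35Space X]
    [AddCommGroup E] [Module ℝ E] [TopologicalSpace E] [IsTopologicalAddGroup E]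
    [ContinuousSMul ℝ E] [LocallyConvexSpace ℝ E] [T2Space E]
    (hX : ∃ K : Set X, IsCompact K ∧ K.Infinite)
    (hE : ContainsCopy E (lp (fun _ : ℕ => ℝ) 1)) :
    ContainsComplementedCopy (Cp X (WeakSpace ℝ E)) c0p := by
  obtain ⟨K, hK, hKinf⟩ := hX
  obtain ⟨x, φ, N, hxK, hφ, hφ1, hφx, hN⟩ := hKinf.exists_seq_disjoint_bumps
  obtain ⟨p, e, hp, hbdd, hsign⟩ := hE.exists_seq_of_lp_one
  obtain ⟨ψ, hψe, hψ⟩ := exists_strongDual_tendsto_zero p hp e hsign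
  have : CompactSpace K := isCompact_iff_compactSpace.1 hK
  -- This makes the weak topology Hausdorff.
  have : SeparatingDual ℝ E := ⟨fun v hv => by
    obtain ⟨g, hg⟩ := geometric_hahn_banach_point_point hv.symm
    exact ⟨g, fun h => by simp [h] at hg⟩⟩
  have heval : ∀ g : StrongDual ℝ E, Continuous fun v : WeakSpace ℝ E =>
      g ((toWeakSpace ℝ E).symm v) :=
    fun g => WeakBilin.eval_continuous (topDualPairing ℝ E).flip g
  have hxN : ∀ n, N (x n) = n := fun n => by
    by_contra h
    simpa [hφx n] using hN n (x n) (Ne.symm h)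
  let w : ℕ → WeakSpace ℝ E := fun n => toWeakSpace ℝ E (e n)
  let T : c0p →L[ℝ] Cp X (WeakSpace ℝ E) :=
    { toFun := fun a => ⟨fun y => (a.1 (N y) * φ (N y) y) • w (N y), by
        refine WeakBilin.continuous_of_continuous_eval _ fun g => ?_
        obtain ⟨C, hC⟩ := hbdd g
        -- Weak boundedness of `e` suffices, since continuity is tested on one functional at a time.
        have hb : Tendsto (fun n => a.1 n * g (e n)) atTop (𝓝 0) :=
          (show Tendsto a.1 atTop (𝓝 0) from a.2).zero_mul_isBoundedUnder_le
            (isBoundedUnder_of ⟨C, hC⟩)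
        refine (continuous_of_disjoint_bumps hφ hφ1 hN hb).congr fun y => ?_
        change _ = g ((a.1 (N y) * φ (N y) y) • e (N y))
        rw [map_smul, smul_eq_mul]
        ring⟩
      map_add' := fun a b => Subtype.ext <| funext fun y => by
        simp [add_mul, add_smul]
      map_smul' := fun c a => Subtype.ext <| funext fun y => by
        simp [mul_assoc, mul_smul]
      cont := by
        refine Continuous.subtype_mk (continuous_pi fun y => ?_) _
        exact (((continuous_apply (N y)).comp continuous_subtype_val).mul_const _).smul
          continuous_const }
  let S : Cp X (WeakSpace ℝ E) →L[ℝ] c0p :=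
    { toFun := fun f => ⟨fun n => ψ n ((toWeakSpace ℝ E).symm (f.1 (x n))),
        -- Compactness of `K` enters here: it puts the values of `S` in `c0p`.
        hψ (fun y : K => (toWeakSpace ℝ E).symm (f.1 y))
          (fun g => (heval g).comp (f.2.comp continuous_subtype_val)) fun n => ⟨x n, hxK n⟩⟩
      map_add' := fun f g => Subtype.ext <| funext fun n => by simp
      map_smul' := fun c f => Subtype.ext <| funext fun n => by simp
      cont := by
        refine Continuous.subtype_mk (continuous_pi fun n => ?_) _
        exact (heval (ψ n)).comp ((continuous_apply (x n)).comp continuous_subtype_val) }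
  refine ContainsComplementedCopy.of_leftInverse T S fun a => Subtype.ext <| funext fun n => ?_
  change ψ n ((a.1 (N (x n)) * φ (N (x n)) (x n)) • e (N (x n))) = a.1 n
  rw [hxN, hφx, mul_one, map_smul, hψe, smul_eq_mul, mul_one]
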